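/- Let $T$ be a complete strongly minimal first-order theory in a countable language (every model is infinite, and in every model each subset of the universe definable with parameters is finite or cofinite). Let $\mathcal{M}$ be its countable saturated model, and consider on $\mathcal{M}$ the pregeometry given by algebraic closure $\mathrm{cl}=\mathrm{acl}_{\mathcal M}$. A set $A\subseteq\mathcal M$ is closed if $\mathrm{cl}(A)=A$, and $\dim(A)$ is the cardinality of any minimal $Y\subseteq A$ with $A\subseteq \mathrm{cl}(Y)$. Suppose that this pregeometry is flat, i.e. 1. it is not disintegrated: there are a nonempty set $A$ and $b\in\mathrm{cl}(A)$ such that $b\notin\mathrm{cl}(\{a\})$ for every $a\in A$; and 2. for all finite-dimensional closed sets $E_1,\dots,E_k$, $$\dim\Big(\bigcup_{i=1}^k E_i\Big)\ \le\ \sum_{\emptyset\neq s\subseteq\{1,\dots,k\}}(-1)^{|s|+1}\dim\Big(\bigcap_{i\in s}E_i\Big).$$ A circuit is a dependent tuple all of whose proper subtuples are independent, where a tuple is independent if none of its entries lies in the closure of the others. Since the pregeometry is not disintegrated, there are circuits with more than two entries; let $n+1$ be the smallest size $>2$ of a circuit in $\mathcal{M}$. Let $p$ be the dimension, with respect to algebraic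 closure, of the prime model of $T$ (the model that embeds elementarily into every model of $T$). Then $$p\le n+1 .$$ -/

import Mathlib

open FirstOrder Cardinal

universe u v w

namespace FlatSM

/-! ### Notions attached to a closure operator `cl : Set X → Set X`

They are only applied to algebraic closure in strongly minimal structures, which is a
combinatorial pregeometry. -/

section Pregeometry

variable {X : Type w}

/-- `Y` is a basis of `A`: a minimal subset of `A` whose closure contains `A`. -/
def IsBasis (cl : Set X → Set X) (A Y : Set X) : Prop :=
  Minimal (fun Z : Set X => Z ⊆ A ∧ A ⊆ cl Z) Y

/-- The dimension of `A`: the cardinality (a natural number or `∞`) of a basis of `A`.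
In a pregeometry bases exist and all bases of `A` have the same cardinality. -/
noncomputable def dim (cl : Set X → Set X) (A : Set X) : ℕ∞ :=
  ⨅ (Y : Set X) (_ : IsBasis cl A Y), Y.encard

/-- A tuple is independent if no entry lies in the closure of the other entries. -/
def IndepTuple {ι : Type*} (cl : Set X → Set X) (a : ι → X) : Prop :=
  ∀ i, a i ∉ cl (a '' {j | j ≠ i})

/-- A circuit is a dependent tuple all of whose proper subtuples are independent. -/
def IsCircuit {m : ℕ} (cl : Set X → Set X) (a : Fin m → X) : Prop :=
  ¬ IndepTuple cl a ∧
    ∀ J : Set (Fin m), J ≠ Set.univ → IndepTuple cl (fun j : J => a j)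

/-- Disintegrated: whatever depends on a (nonempty) set depends on a single element of it. -/
def IsDisintegrated (cl : Set X → Set X) : Prop :=
  ∀ A : Set X, A.Nonempty → ∀ b ∈ cl A, ∃ a ∈ A, b ∈ cl {a}

/-- `Δ(E₁, …, E_k) = ∑_{∅ ≠ s ⊆ {1, …, k}} (-1)^{|s|+1} dim (⋂_{i ∈ s} E_i)`, for
finite-dimensional closed sets `E_i`. -/
noncomputable def flatDelta (cl : Set X → Set X) {k : ℕ} (E : Fin k → Set X) : ℤ :=
  ∑ s : Finset (Fin k) with s.Nonempty,
    (-1 : ℤ) ^ (s.card + 1) * ((dim cl (⋂ i ∈ s, E i)).toNat : ℤ)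

/-- Flat: not disintegrated, and `dim (⋃ E_i) ≤ Δ(E₁, …, E_k)` for all finite collections of
finite-dimensional closed sets. (The union is then finite-dimensional as well.) -/
def IsFlat (cl : Set X → Set X) : Prop :=
  ¬ IsDisintegrated cl ∧
    ∀ (k : ℕ) (E : Fin k → Set X), (∀ i, cl (E i) = E i ∧ dim cl (E i) ≠ ⊤) →
      ((dim cl (⋃ i, E i)).toNat : ℤ) ≤ flatDelta cl E

end Pregeometry

section ModelTheory

variable (L : FirstOrder.Language.{u, v})

/-- Model-theoretic algebraic closure: the union of the finite `A`-definable subsets of `M`. -/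
def acl (M : Type w) [L.Structure M] (A : Set M) : Set M :=
  {b | ∃ S : Set M, A.Definable₁ L S ∧ S.Finite ∧ b ∈ S}

/-- `M` is saturated: every set of formulas in one variable with parameters from a set
`A ⊆ M`, `|A| < |M|`, that is finitely satisfiable in `M` is realized in `M`. -/
def IsSaturated (M : Type w) [L.Structure M] : Prop :=
  ∀ A : Set M, #A < #M → ∀ p : Set (L[[A]].Formula Unit),
    (∀ q : Finset (L[[A]].Formula Unit), (q : Set (L[[A]].Formula Unit)) ⊆ p →
      ∃ x : M, ∀ φ ∈ q, φ.Realize (fun _ => x)) →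
    ∃ x : M, ∀ φ ∈ p, φ.Realize (fun _ => x)

variable {L}

/-- A complete theory is strongly minimal if its models are infinite and in each of them every
subset definable with parameters is finite or cofinite. (For a countable language it does not
matter in which universe `w` the models are taken, by Löwenheim–Skolem.) -/
def IsStronglyMinimal (T : L.Theory) : Prop :=
  T.IsComplete ∧ ∀ M : T.ModelType.{u, v, w}, Infinite M ∧
    ∀ S : Set M, (Set.univ : Set M).Definable₁ L S → S.Finite ∨ Sᶜ.Finite

/-- A prime model of `T`: a model that embeds elementarily into every model of `T`. -/
def IsPrimeModel (T : L.Theory) (P : Type w) [L.Structure P] : Prop :=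
  P ⊨ T ∧ ∀ N : T.ModelType.{u, v, w}, Nonempty (P ↪ₑ[L] N)

end ModelTheory

end FlatSM

/-! The goal is to show that in `M` the closure of any `n + 1` independent elements is infinite. An
infinite algebraically closed subset of a minimal structure is an elementary substructure, so the
prime model then embeds in one spanned by at most `n + 1` elements, and its dimension is at most `n
+ 1` (`exists_elementaryEmbedding_acl`, `dim_univ_le`).

Call the closure of a single element outside `cl ∅` a point. Minimality of `n + 1` says that a
closed set of dimension `d < n` has exactly `d` points. All independent `n`-tuples have the same
type, so the circuit of size `n + 1` forces every closed set of dimension `n` to have at least `n +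
1` points (`exists_mem_acl_of_indepTuple`). Distinct closed sets of dimension `n` meet in dimension
less than `n`, where dimension counts points. Inclusion-exclusion therefore turns flatness into `dim
F ≤ |F| - ∑ (|E| - n)`, with `|·|` the number of points and `F` the union of the sets `E`
(`dim_le_of_isFlat`).

If `F` of dimension `n + 1` were finite, this could be applied to all `n`-dimensional closed subsets
of `F` containing `R` or containing `R'`, where `R` and `R'` have `n - 1` elements and together span
dimension `n`. Those through `R` alone already account for every point of `F`, and those through
`R'` push the right side below `n + 1` (`infinite_cl_aux`). -/

namespace FlatSM

/-! ### Definable families and the definability of fibre sizes -/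

section Fiber

open Set FirstOrder.Language

variable {L : FirstOrder.Language.{u, v}} {M : Type w} [L.Structure M]

/-- The set of `x` such that `(v, x) ∈ D`. -/
def fiber {M : Type*} {α : Type*} (D : Set (α ⊕ Fin 1 → M)) (v : α → M) : Set M :=
  {x | Sum.elim v (fun _ => x) ∈ D}

theorem mem_fiber {M : Type*} {α : Type*} {D : Set (α ⊕ Fin 1 → M)} {v : α → M} {x : M} :
    x ∈ fiber D v ↔ Sum.elim v (fun _ => x) ∈ D := Iff.rfl

theorem natCast_le_encard_iff {X : Type*} (S : Set X) (k : ℕ) :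
    (k : ℕ∞) ≤ S.encard ↔ ∃ u : Fin k → X, Function.Injective u ∧ ∀ i, u i ∈ S := by
  constructor
  · intro h
    obtain ⟨t, hts, ht⟩ := Set.exists_subset_encard_eq h
    have htf : t.Finite := Set.finite_of_encard_eq_coe ht
    have hc : Nat.card t = k := by
      rw [Nat.card_coe_set_eq, Set.ncard, ht]; rfl
    have := htf.to_subtype
    let e := (Finite.equivFinOfCardEq hc).symm
    exact ⟨fun i => e i, Subtype.val_injective.comp e.injective, fun i => hts (e i).2⟩
  · rintro ⟨u, hu, hS⟩
    calc (k : ℕ∞) = (Set.range u).encard := by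
          rw [← Set.image_univ, hu.encard_image, Set.encard_univ]; simp
      _ ≤ S.encard := Set.encard_le_encard (by rintro _ ⟨i, rfl⟩; exact hS i)

/-- Having at least `k` elements is first-order: there are `k` pairwise distinct witnesses. Every
uniform finiteness argument below rests on bounding fibres in this way. -/
theorem definable_le_encard_fiber {α : Type*} {A : Set M} {D : Set (α ⊕ Fin 1 → M)}
    (hD : A.Definable L D) (k : ℕ) : A.Definable L {v | (k : ℕ∞) ≤ (fiber D v).encard} := by
  have h1 : A.Definable L {w : α ⊕ Fin k → M |
      (∀ i, w ∘ Sum.map id (fun _ : Fin 1 => i) ∈ D) ∧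
      ∀ p : {p : Fin k × Fin k // p.1 ≠ p.2}, w (Sum.inr p.1.1) ≠ w (Sum.inr p.1.2)} := by
    rw [Set.ofPred_and]
    refine Definable.inter ?_ ?_
    · rw [Set.ofPred_forall]
      exact definable_iInter_of_finite fun i => hD.preimage_comp _
    · rw [Set.ofPred_forall]
      refine definable_iInter_of_finite fun p => ?_
      exact (DefinableFun.ofPred_eq (DefinableFun.proj L) (DefinableFun.proj L)).compl
  convert! h1.exists_of_finite using 1
  ext v
  simp only [mem_ofPred_eq, natCast_le_encard_iff]
  refine exists_congr fun u => ?_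
  rw [and_comm]
  refine and_congr ?_ ?_
  · refine forall_congr' fun i => ?_
    rw [mem_fiber]
    exact iff_of_eq (congrArg (· ∈ D) (by ext (x | x) <;> simp))
  · constructor
    · intro h p hp
      exact p.2 (h hp)
    · intro h i j hij
      by_contra hne
      exact h ⟨(i, j), hne⟩ hij

theorem definable_encard_fiber_le {α : Type*} {A : Set M} {D : Set (α ⊕ Fin 1 → M)}
    (hD : A.Definable L D) (k : ℕ) : A.Definable L {v | (fiber D v).encard ≤ k} := by
  convert! (definable_le_encard_fiber hD (k + 1)).compl using 1
  ext v
  simp only [mem_ofPred_eq, mem_compl_iff, not_le]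
  push_cast
  exact (ENat.lt_add_one_iff (ENat.natCast_ne_top k)).symm

theorem definable_fiber {α : Type*} {A B : Set M} {D : Set (α ⊕ Fin 1 → M)}
    (hD : A.Definable L D) (hAB : A ⊆ B) {c : α → M} (hc : ∀ i, c i ∈ B) :
    B.Definable₁ L (fiber D c) := by
  classical
  obtain ⟨φ, rfl⟩ := definable_iff_exists_formula_sum.1 hD
  refine definable_iff_exists_formula_sum.2 ⟨φ.relabel (Sum.elim
    (fun a : A => Sum.inl ⟨a, hAB a.2⟩) (Sum.elim (fun i => Sum.inl ⟨c i, hc i⟩) Sum.inr)), ?_⟩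
  ext x
  simp only [mem_ofPred_eq, mem_fiber, Formula.realize_relabel]
  refine iff_of_eq (congrArg φ.Realize ?_)
  ext (a | i | j)
  · simp
  · simp
  · simp [Subsingleton.elim j 0]

/-- The parameters in `c` become variables, so that the same family `D` can be evaluated at another
tuple. -/
theorem exists_definable_fiber {α : Type*} {A : Set M} (c : α → M) {S : Set M}
    (hS : (A ∪ range c).Definable₁ L S) :
    ∃ D : Set (α ⊕ Fin 1 → M), A.Definable L D ∧ S = fiber D c := by
  classical
  obtain ⟨φ, hφ⟩ := definable_iff_exists_formula_sum.1 hS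
  have key : ∀ t : ↥(A ∪ range c), ∃ s : A ⊕ α, Sum.elim (fun a : A => (a : M)) c s = t := by
    rintro ⟨t, ht | ⟨i, rfl⟩⟩
    · exact ⟨Sum.inl ⟨t, ht⟩, rfl⟩
    · exact ⟨Sum.inr i, rfl⟩
  choose g hg using key
  let φ' : L.Formula (A ⊕ (α ⊕ Fin 1)) := φ.relabel
    (Sum.elim (fun t => Sum.map id Sum.inl (g t)) (fun j => Sum.inr (Sum.inr j)))
  refine ⟨{v | φ'.Realize (Sum.elim (↑) v)}, definable_iff_exists_formula_sum.2 ⟨φ', rfl⟩, ?_⟩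
  ext x
  have hx : x ∈ S ↔ (fun _ : Fin 1 => x) ∈ {x : Fin 1 → M | x 0 ∈ S} := Iff.rfl
  rw [hx, hφ]
  simp only [mem_ofPred_eq, mem_fiber, φ', Formula.realize_relabel]
  refine iff_of_eq (congrArg φ.Realize ?_)
  ext (t | j)
  · simp only [Sum.elim_inl, Function.comp_apply]
    rw [← hg t]
    rcases g t with a | i <;> simp
  · simp

end Fiber

/-! ### Algebraic closure in a minimal structure is a pregeometry -/

section Acl

open Set FirstOrder.Language

variable (L : FirstOrder.Language.{u, v}) (M : Type w) [L.Structure M]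

/-- A structure is minimal if it is infinite and its parametrically definable
subsets are finite or cofinite. -/
def IsMinimalStructure : Prop :=
  Infinite M ∧ ∀ S : Set M, (Set.univ : Set M).Definable₁ L S → S.Finite ∨ Sᶜ.Finite

variable {L M}

theorem mem_acl_of_mem_fiber {α : Type*} {A B : Set M} {D : Set (α ⊕ Fin 1 → M)}
    (hD : A.Definable L D) (hAB : A ⊆ B) {c : α → M} (hc : ∀ i, c i ∈ B)
    (hfin : (fiber D c).Finite) {x : M} (hx : x ∈ fiber D c) : x ∈ acl L M B :=
  ⟨_, definable_fiber hD hAB hc, hfin, hx⟩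

theorem exists_fiber_of_mem_acl {α : Type*} {A : Set M} (c : α → M) {x : M}
    (hx : x ∈ acl L M (A ∪ range c)) :
    ∃ D : Set (α ⊕ Fin 1 → M), A.Definable L D ∧ (fiber D c).Finite ∧ x ∈ fiber D c := by
  obtain ⟨S, hS, hf, hxS⟩ := hx
  obtain ⟨D, hD, rfl⟩ := exists_definable_fiber c hS
  exact ⟨D, hD, hf, hxS⟩

theorem acl_mono : Monotone (acl L M) := fun _ _ hAB _ ⟨S, hS, hf, hx⟩ =>
  ⟨S, Definable.mono hS hAB, hf, hx⟩

theorem subset_acl (A : Set M) : A ⊆ acl L M A := fun a ha =>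
  ⟨{a}, Definable.singleton_of_mem L ha, finite_singleton a, rfl⟩

theorem acl_finitary {A : Set M} {x : M} (hx : x ∈ acl L M A) :
    ∃ A₀ ⊆ A, A₀.Finite ∧ x ∈ acl L M A₀ := by
  obtain ⟨S, hS, hf, hx⟩ := hx
  obtain ⟨A₀, h, hd⟩ := definable_iff_finitely_definable.1 hS
  exact ⟨A₀, h, A₀.finite_toSet, S, hd, hf, hx⟩

theorem insert_eq_union_range_unit (c : M) (A : Set M) :
    insert c A = A ∪ range (fun _ : Fin 1 => c) := by
  simp

theorem acl_trans_insert {A : Set M} {b c : M} (hb : b ∈ acl L M (insert c A))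
    (hc : c ∈ acl L M A) : b ∈ acl L M A := by
  rw [insert_eq_union_range_unit] at hb
  obtain ⟨D, hD, hf, hbD⟩ := exists_fiber_of_mem_acl _ hb
  obtain ⟨C, hC, hCf, hcC⟩ := hc
  obtain ⟨k, hk⟩ := hf.exists_encard_eq_coe
  -- Other `y ∈ C` may have infinite fibres; keeping only those with at most `k` elements makes the
  -- union finite, and `c` itself survives.
  refine ⟨{x | ∃ y ∈ C, x ∈ fiber D (fun _ => y) ∧ (fiber D (fun _ => y)).encard ≤ k}, ?_, ?_,
    c, hcC, hbD, hk.le⟩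
  · have h1 : A.Definable L {w : Fin 1 ⊕ Fin 1 → M | w (Sum.inr 0) ∈ C} :=
      hC.preimage_comp (fun _ : Fin 1 => (Sum.inr 0 : Fin 1 ⊕ Fin 1))
    have h2 := hD.preimage_comp (Sum.swap : Fin 1 ⊕ Fin 1 → Fin 1 ⊕ Fin 1)
    have h3 := (definable_encard_fiber_le hD k).preimage_comp
      (Sum.inr : Fin 1 → Fin 1 ⊕ Fin 1)
    refine (congrArg (A.Definable L) ?_).mp (h1.inter (h2.inter h3)).exists_of_finite
    ext x
    simp only [mem_ofPred_eq, mem_inter_iff, mem_preimage, mem_fiber]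
    constructor
    · rintro ⟨u, hu, h, h'⟩
      have hu' : u = fun _ => u 0 := by ext i; rw [Subsingleton.elim i 0]
      refine ⟨u 0, hu, ?_, ?_⟩
      · convert! h using 1
        ext (i | i) <;> simp [Subsingleton.elim i 0]
      · rw [← hu']; exact h'
    · rintro ⟨y, hy, h, h'⟩
      refine ⟨fun _ => y, hy, ?_, h'⟩
      convert! h using 1
      ext (i | i) <;> simp [Subsingleton.elim i 0]
  · have : {x | ∃ y ∈ C, x ∈ fiber D (fun _ => y) ∧ (fiber D (fun _ => y)).encard ≤ k} ⊆
        ⋃ y ∈ {y ∈ C | (fiber D (fun _ => y)).encard ≤ k}, fiber D (fun _ => y) := by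
      rintro x ⟨y, hy, h, h'⟩
      exact mem_biUnion (x := y) ⟨hy, h'⟩ h
    refine Finite.subset (Finite.biUnion (hCf.subset (sep_subset _ _)) fun y hy => ?_) this
    exact finite_of_encard_le_coe hy.2

theorem acl_idem (A : Set M) : acl L M (acl L M A) = acl L M A := by
  refine Subset.antisymm (fun x hx => ?_) (subset_acl _)
  obtain ⟨A₀, h, hf, hx⟩ := acl_finitary hx
  suffices H : ∀ B : Set M, B.Finite → B ⊆ acl L M A → ∀ x ∈ acl L M (B ∪ A), x ∈ acl L M A from
    H A₀ hf h x (acl_mono subset_union_left hx)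
  intro B hB
  induction B, hB using Set.Finite.induction_on with
  | empty => intro _ x hx; simpa using hx
  | @insert a s _ _ ih =>
    intro hs x hx
    refine ih ((subset_insert _ _).trans hs) x ?_
    rw [insert_union] at hx
    exact acl_trans_insert hx (acl_mono subset_union_right (hs (mem_insert _ _)))

/-- A counting argument: write `b ∈ fiber D c` with `k` elements in the fibre, and let `E` be the
transposed family restricted to fibres of size at most `k`. If the fibre of `E` at `b` is finite, it
witnesses `c ∈ acl (A b)`. If it is cofinite, then so are infinitely many fibres of `E`, with a
common bound on the complements, because `b` is not algebraic over `A`. -/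
theorem acl_exchange (hM : IsMinimalStructure L M) {A : Set M} {b c : M}
    (hb : b ∈ acl L M (insert c A)) (hbA : b ∉ acl L M A) : c ∈ acl L M (insert b A) := by
  have := hM.1
  rw [insert_eq_union_range_unit] at hb
  obtain ⟨D, hD, hf, hbD⟩ := exists_fiber_of_mem_acl _ hb
  obtain ⟨k, hk⟩ := hf.exists_encard_eq_coe
  let E : Set (Fin 1 ⊕ Fin 1 → M) :=
    {w | w ∘ Sum.swap ∈ D ∧ (fiber D (w ∘ Sum.inr)).encard ≤ k}
  have hE : A.Definable L E := (hD.preimage_comp Sum.swap).inter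
    ((definable_encard_fiber_le hD k).preimage_comp Sum.inr)
  have hmem : ∀ x y, y ∈ fiber E (fun _ => x) ↔
      x ∈ fiber D (fun _ => y) ∧ (fiber D (fun _ => y)).encard ≤ k := by
    intro x y
    simp only [mem_fiber, E, mem_ofPred_eq]
    refine and_congr (iff_of_eq (congrArg (· ∈ D) ?_)) Iff.rfl
    ext (i | i) <;> simp
  have hcE : c ∈ fiber E (fun _ => b) := (hmem b c).2 ⟨hbD, hk.le⟩
  rcases hM.2 _ (definable_fiber (B := univ) hE (subset_univ _) (c := fun _ => b)
    (fun _ => mem_univ _)) with hfin | hcof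
  · exact mem_acl_of_mem_fiber hE (subset_insert _ _) (fun _ => mem_insert _ _) hfin hcE
  exfalso
  obtain ⟨l, hl⟩ := hcof.exists_encard_eq_coe
  have hX := definable_encard_fiber_le hE.compl l
  have hS : A.Definable₁ L {x | (fiber Eᶜ (fun _ : Fin 1 => x)).encard ≤ l} := by
    refine (congrArg (A.Definable L) ?_).mp hX
    ext x
    have : x = fun _ => x 0 := by ext i; rw [Subsingleton.elim i 0]
    simp only [mem_ofPred_eq]
    rw [← this]
  have hSinf : {x | (fiber Eᶜ (fun _ : Fin 1 => x)).encard ≤ l}.Infinite := fun h =>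
    hbA ⟨_, hS, h, hl.le⟩
  -- Any `k + 1` such cofinite fibres share an element `y`; then `fiber D y` contains `k + 1`
  -- elements although its size is at most `k`.
  obtain ⟨t, ht, htk⟩ := hSinf.exists_subset_card_eq (k + 1)
  have hun : (⋃ x ∈ t, fiber Eᶜ (fun _ : Fin 1 => x)).Finite :=
    t.finite_toSet.biUnion fun x hx => finite_of_encard_le_coe (ht hx)
  obtain ⟨y, hy⟩ := hun.infinite_compl.nonempty
  simp only [mem_compl_iff, mem_iUnion, not_exists] at hy
  have hy' : ∀ x ∈ t, x ∈ fiber D (fun _ => y) ∧ (fiber D (fun _ => y)).encard ≤ k :=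
    fun x hx => (hmem x y).1 (not_not.1 (hy x hx))
  obtain ⟨x₀, hx₀⟩ : t.Nonempty := Finset.card_pos.1 (by omega)
  have h1 : ((k + 1 : ℕ) : ℕ∞) ≤ k := by
    rw [← htk, ← Set.encard_coe_eq_coe_finsetCard]
    exact (encard_le_encard fun x hx => (hy' x hx).1).trans (hy' x₀ hx₀).2
  exact absurd (Nat.cast_le.1 h1) (by omega)

end Acl

/-! ### Pregeometries as finitary matroids -/

section Matroid

open Set

variable {X : Type*} {cl : Set X → Set X}

/-- The axioms of a combinatorial pregeometry. -/
structure IsPregeometry (cl : Set X → Set X) : Prop where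
  mono : Monotone cl
  subset : ∀ A, A ⊆ cl A
  idem : ∀ A, cl (cl A) = cl A
  finitary : ∀ {A x}, x ∈ cl A → ∃ A₀ ⊆ A, A₀.Finite ∧ x ∈ cl A₀
  exchange : ∀ {A b c}, b ∈ cl (insert c A) → b ∉ cl A → c ∈ cl (insert b A)

/-- A set is independent if none of its elements lies in the closure of the others. -/
def IndepSet (cl : Set X → Set X) (I : Set X) : Prop := ∀ i ∈ I, i ∉ cl (I \ {i})

namespace IsPregeometry

theorem indepSet_subset (h : IsPregeometry cl) {I J : Set X} (hJ : IndepSet cl J) (hIJ : I ⊆ J) : IndepSet cl I :=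
  fun i hi hc => hJ i (hIJ hi) (h.mono (sdiff_subset_sdiff_left hIJ) hc)

theorem indepSet_insert (h : IsPregeometry cl) {I : Set X} (hI : IndepSet cl I) {x : X} (hx : x ∉ cl I) :
    IndepSet cl (insert x I) := by
  have hxI : x ∉ I := fun hx' => hx (h.subset _ hx')
  rintro i (rfl | hi) hc
  · exact hx (by simpa [hxI] using hc)
  · have hne : x ≠ i := fun e => hxI (e ▸ hi)
    rw [← insert_sdiff_singleton_comm hne] at hc
    refine hx ?_
    have := h.exchange hc (hI i hi)
    rwa [insert_sdiff_singleton, insert_eq_of_mem hi] at this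

theorem cl_subset_cl (h : IsPregeometry cl) {A B : Set X} (hAB : A ⊆ cl B) : cl A ⊆ cl B :=
  (h.mono hAB).trans_eq (h.idem B)

/-- The matroid of a pregeometry. -/
def matroid (h : IsPregeometry cl) : Matroid X :=
  (IndepMatroid.ofFinitary univ (IndepSet cl) (fun i hi => hi.elim)
    (fun _ _ hJ hIJ => h.indepSet_subset hJ hIJ)
    (by
      -- Augmentation: if no element of `B` enlarges `I`, then `B ⊆ cl I`. A maximal `B` spans
      -- everything, hence so does `I`, and `I` is already maximal.
      intro I B hI hImax hB
      by_contra! hcon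
      have hBI : B ⊆ cl I := fun x hx => by
        by_contra hxI
        exact hcon x ⟨hx, fun hx' => hxI (h.subset _ hx')⟩ (h.indepSet_insert hI hxI)
      have huniv : ∀ x, x ∈ cl I := fun x => by
        refine h.cl_subset_cl hBI ?_
        by_contra hx
        exact hx (h.subset _ (hB.2 (h.indepSet_insert hB.1 hx) (subset_insert _ _)
          (mem_insert _ _)))
      refine hImax ⟨hI, fun J hJ hIJ y hy => ?_⟩
      by_contra hyI
      exact hJ y hy (h.mono (show I ⊆ J \ {y} from fun z hz => ⟨hIJ hz, fun e => hyI (e ▸ hz)⟩) (huniv y)))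
    (by
      intro I hI i hi hc
      obtain ⟨F, hF, hFf, hiF⟩ := h.finitary hc
      refine hI (insert i F) (insert_subset hi (hF.trans sdiff_subset)) (hFf.insert i) i
        (mem_insert _ _) (h.mono (show F ⊆ insert i F \ {i} from fun z hz =>
        ⟨mem_insert_of_mem _ hz, (hF hz).2⟩) hiF))
    (fun _ _ => subset_univ _)).matroid

theorem matroid_indep (h : IsPregeometry cl) {I : Set X} : h.matroid.Indep I ↔ IndepSet cl I := Iff.rfl

theorem subset_ground (h : IsPregeometry cl) (A : Set X) : A ⊆ h.matroid.E := subset_univ A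

/-- On independent sets both closures consist of the elements that cannot be added independently;
the general case passes to a basis. -/
theorem closure_eq (h : IsPregeometry cl) (A : Set X) : h.matroid.closure A = cl A := by
  have key : ∀ I, IndepSet cl I → h.matroid.closure I = cl I := by
    intro I hI
    ext x
    rw [Matroid.Indep.mem_closure_iff' (h.matroid_indep.2 hI)]
    constructor
    · rintro ⟨-, hx⟩
      by_contra hxI
      exact hxI (h.subset _ (hx (h.indepSet_insert hI hxI)))
    · refine fun hx => ⟨mem_univ x, fun hins => ?_⟩
      by_contra hxI
      exact hins x (mem_insert _ _) (by simpa [hxI] using hx)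
  obtain ⟨I, hI⟩ := h.matroid.exists_isBasis A (h.subset_ground A)
  rw [← hI.closure_eq_closure, key I hI.indep]
  refine Subset.antisymm (h.mono hI.subset) (h.cl_subset_cl ?_)
  rw [← key I hI.indep]
  exact hI.subset_closure

theorem isBasis_iff (h : IsPregeometry cl) {A Y : Set X} : IsBasis cl A Y ↔ h.matroid.IsBasis Y A := by
  constructor
  · rintro ⟨⟨hYA, hAY⟩, hmin⟩
    rw [Matroid.isBasis_iff_indep_subset_closure, h.closure_eq]
    refine ⟨fun y hy hc => ?_, hYA, hAY⟩
    have hY : Y ⊆ cl (Y \ {y}) := fun z hz => by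
      by_cases e : z = y
      · exact e ▸ hc
      · exact h.subset _ ⟨hz, e⟩
    have := hmin (y := Y \ {y}) ⟨sdiff_subset.trans hYA, hAY.trans (h.cl_subset_cl hY)⟩ sdiff_subset
    exact (this hy).2 rfl
  · intro hb
    refine ⟨⟨hb.subset, ?_⟩, fun Z hZ hZY => ?_⟩
    · rw [← h.closure_eq]; exact hb.subset_closure
    · exact (hb.eq_of_closure_subset hZY (by rw [h.closure_eq]; exact hZ.2)).ge

theorem dim_eq (h : IsPregeometry cl) (A : Set X) : dim cl A = h.matroid.eRk A := by
  obtain ⟨I, hI⟩ := h.matroid.exists_isBasis A (h.subset_ground A)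
  refine le_antisymm ?_ ?_
  · exact (iInf₂_le I (h.isBasis_iff.2 hI)).trans_eq hI.encard_eq_eRk
  · exact le_iInf₂ fun Y hY => (h.isBasis_iff.1 hY).encard_eq_eRk.ge

end IsPregeometry

end Matroid

theorem isPregeometry_acl {L : FirstOrder.Language.{u, v}} {M : Type w} [L.Structure M]
    (hM : IsMinimalStructure L M) : IsPregeometry (acl L M) :=
  ⟨acl_mono, subset_acl, acl_idem, acl_finitary, acl_exchange hM⟩

/-! ### Counting points of closed sets, and flatness -/

section Points

open Set

variable {X : Type*} {cl : Set X → Set X}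

/-- The points (closures of single elements outside `cl ∅`) contained in `E`. -/
def points (cl : Set X → Set X) (E : Set X) : Set (Set X) :=
  {P | (∃ x, x ∉ cl ∅ ∧ P = cl {x}) ∧ P ⊆ E}

theorem points_mono {E F : Set X} (hEF : E ⊆ F) : points cl E ⊆ points cl F :=
  fun _ hP => ⟨hP.1, hP.2.trans hEF⟩

namespace IsPregeometry

theorem mem_cl_singleton (h : IsPregeometry cl) (x : X) : x ∈ cl {x} := h.subset _ rfl

theorem cl_singleton_subset (h : IsPregeometry cl) {E : Set X} (hE : cl E = E) {x : X}
    (hx : x ∈ E) : cl {x} ⊆ E := by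
  rw [← hE]
  exact h.mono (singleton_subset_iff.2 hx)

theorem cl_singleton_eq (h : IsPregeometry cl) {x a : X} (hx : x ∉ cl ∅) (hxa : x ∈ cl {a}) :
    cl {x} = cl {a} := by
  refine Subset.antisymm (h.cl_subset_cl (singleton_subset_iff.2 hxa))
    (h.cl_subset_cl (singleton_subset_iff.2 ?_))
  simpa using h.exchange (A := ∅) (b := x) (c := a) (by simpa using hxa) hx

theorem points_finite (h : IsPregeometry cl) {F : Set X} (hF : F.Finite) :
    (points cl F).Finite := by
  refine (hF.image (fun x => cl {x})).subset ?_
  rintro _ ⟨⟨x, -, rfl⟩, hP⟩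
  exact ⟨x, hP (h.mem_cl_singleton x), rfl⟩

theorem notMem_cl_empty (h : IsPregeometry cl) {I : Set X} (hI : IndepSet cl I) {a : X}
    (ha : a ∈ I) : a ∉ cl ∅ := fun hc => hI a ha (h.mono (empty_subset _) hc)

theorem injOn_cl_singleton (h : IsPregeometry cl) {I : Set X} (hI : IndepSet cl I) :
    InjOn (fun a => cl {a}) I := by
  intro a ha b hb hab
  by_contra hne
  refine hI a ha (h.mono (show {b} ⊆ I \ {a} from ?_) ?_)
  · rintro _ rfl
    exact ⟨hb, fun e => hne e.symm⟩
  · have : cl {a} = cl {b} := hab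
    rw [← this]
    exact h.mem_cl_singleton a

/-- Under disintegration `a ↦ cl {a}` is a bijection from the basis onto the points. -/
theorem encard_points_eq (h : IsPregeometry cl) {I : Set X} (hI : IndepSet cl I)
    (hcl : ∀ x ∈ cl I, x ∉ cl ∅ → ∃ a ∈ I, x ∈ cl {a}) :
    (points cl (cl I)).encard = I.encard := by
  rw [← (h.injOn_cl_singleton hI).encard_image]
  congr 1
  ext P
  constructor
  · rintro ⟨⟨x, hx, rfl⟩, hP⟩
    obtain ⟨a, ha, hxa⟩ := hcl x (hP (h.mem_cl_singleton x)) hx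
    exact ⟨a, ha, (h.cl_singleton_eq hx hxa).symm⟩
  · rintro ⟨a, ha, rfl⟩
    exact ⟨⟨a, h.notMem_cl_empty hI ha, rfl⟩, h.mono (singleton_subset_iff.2 ha)⟩

theorem lt_encard_points (h : IsPregeometry cl) {I : Set X} (hI : IndepSet cl I)
    {d : X} (hd : d ∈ cl I) (hd₀ : d ∉ cl ∅) (hda : ∀ a ∈ I, d ∉ cl {a}) :
    I.encard + 1 ≤ (points cl (cl I)).encard := by
  have hdI : d ∉ I := fun hc => hda d hc (h.mem_cl_singleton d)
  have hinj : InjOn (fun a => cl {a}) (insert d I) := by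
    rw [injOn_insert hdI]
    refine ⟨h.injOn_cl_singleton hI, ?_⟩
    rintro ⟨a, ha, hc⟩
    have hc : cl {a} = cl {d} := hc
    exact hda a ha (hc ▸ h.mem_cl_singleton d)
  rw [← encard_insert_of_notMem hdI, ← hinj.encard_image]
  refine encard_le_encard ?_
  rintro _ ⟨a, rfl | ha, rfl⟩
  · exact ⟨⟨a, hd₀, rfl⟩, h.cl_subset_cl (singleton_subset_iff.2 hd)⟩
  · exact ⟨⟨a, h.notMem_cl_empty hI ha, rfl⟩, h.mono (singleton_subset_iff.2 ha)⟩

theorem points_iUnion (h : IsPregeometry cl) {ι : Type*} {E : ι → Set X}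
    (hE : ∀ i, cl (E i) = E i) : points cl (⋃ i, E i) = ⋃ i, points cl (E i) := by
  ext P
  constructor
  · rintro ⟨⟨x, hx, rfl⟩, hP⟩
    obtain ⟨i, hi⟩ := mem_iUnion.1 (hP (h.mem_cl_singleton x))
    exact mem_iUnion.2 ⟨i, ⟨x, hx, rfl⟩, h.cl_singleton_subset (hE i) hi⟩
  · intro hP
    obtain ⟨i, hi⟩ := mem_iUnion.1 hP
    exact ⟨hi.1, hi.2.trans (subset_iUnion E i)⟩

/-- If all intersections of at least two of the closed sets `E i` have as many points as their
dimension, `Δ` is computed by inclusion-exclusion for sets of points. -/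
theorem flatDelta_eq (h : IsPregeometry cl) {k : ℕ} {E : Fin k → Set X}
    (hE : ∀ i, cl (E i) = E i) (hfin : (points cl (⋃ i, E i)).Finite)
    (hdim : ∀ s : Finset (Fin k), 2 ≤ s.card →
      dim cl (⋂ i ∈ s, E i) = (points cl (⋂ i ∈ s, E i)).encard) :
    flatDelta cl E = (points cl (⋃ i, E i)).ncard -
      ∑ i, (((points cl (E i)).ncard : ℤ) - (dim cl (E i)).toNat) := by
  classical
  have hf : ∀ i, (points cl (E i)).Finite := fun i =>
    hfin.subset (points_mono (subset_iUnion E i))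
  let S : Fin k → Finset (Set X) := fun i => (hf i).toFinset
  have hU : ((Finset.univ : Finset (Fin k)).biUnion S).card = (points cl (⋃ i, E i)).ncard := by
    rw [← Set.ncard_coe_finset, h.points_iUnion hE]
    congr 1
    ext P
    simp [S]
  have hinf : ∀ (s : Finset (Fin k)) (hs : s.Nonempty),
      (s.inf' hs S).card = (points cl (⋂ i ∈ s, E i)).ncard := by
    intro s hs
    rw [← Set.ncard_coe_finset]
    congr 1
    ext P
    rw [Finset.mem_coe, Finset.mem_inf']
    simp only [S, Set.Finite.mem_toFinset, points, mem_ofPred_eq, subset_iInter_iff]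
    exact ⟨fun hP => ⟨(hP _ hs.choose_spec).1, fun i hi => (hP i hi).2⟩,
      fun hP i hi => ⟨hP.1, hP.2 i hi⟩⟩
  have hIE := Finset.inclusion_exclusion_card_biUnion Finset.univ S
  rw [hU] at hIE
  have hIE' : ((points cl (⋃ i, E i)).ncard : ℤ) =
      ∑ s : Finset (Fin k) with s.Nonempty,
        (-1 : ℤ) ^ (s.card + 1) * ((points cl (⋂ i ∈ s, E i)).ncard : ℤ) := by
    rw [hIE, Finset.powerset_univ, ← Finset.sum_coe_sort (Finset.univ.filter _)]
    refine Finset.sum_congr rfl fun t _ => ?_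
    rw [hinf]
  rw [hIE', flatDelta, eq_sub_iff_add_eq, ← eq_sub_iff_add_eq', ← Finset.sum_sub_distrib]
  symm
  -- In the difference of the two alternating sums, the terms with `|s| ≥ 2` vanish by `hdim`; only
  -- singletons remain.
  rw [← Finset.sum_subset (s₁ := Finset.univ.map ⟨fun i : Fin k => ({i} : Finset (Fin k)),
    Finset.singleton_injective⟩)]
  · rw [Finset.sum_map]
    refine Finset.sum_congr rfl fun i _ => ?_
    simp
  · intro s hs
    obtain ⟨i, -, rfl⟩ := Finset.mem_map.1 hs
    simp
  · intro s hs hs'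
    have h0 : s.card ≠ 0 := by simpa [Finset.nonempty_iff_ne_empty] using hs
    have h1 : s.card ≠ 1 := fun h1 => by
      obtain ⟨i, rfl⟩ := Finset.card_eq_one.1 h1
      simp at hs'
    rw [hdim s (by omega), Set.ncard, sub_self]

theorem cl_biInter (h : IsPregeometry cl) {ι : Type*} {E : ι → Set X}
    (hE : ∀ i, cl (E i) = E i) (s : Finset ι) : cl (⋂ i ∈ s, E i) = ⋂ i ∈ s, E i := by
  refine Subset.antisymm (subset_iInter₂ fun i hi => ?_) (h.subset _)
  rw [← hE i]
  exact h.mono (biInter_subset_of_mem hi)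

theorem dim_cl_of_indepSet (h : IsPregeometry cl) {I : Set X} (hI : IndepSet cl I) :
    dim cl (cl I) = I.encard := by
  rw [h.dim_eq, ← h.closure_eq, Matroid.eRk_closure_eq, (h.matroid_indep.2 hI).eRk_eq_encard]

theorem exists_indepSet_cl_eq (h : IsPregeometry cl) {E : Set X} (hE : cl E = E) :
    ∃ I, IndepSet cl I ∧ cl I = E ∧ I.encard = dim cl E := by
  obtain ⟨I, hI⟩ := h.matroid.exists_isBasis E (h.subset_ground E)
  refine ⟨I, hI.indep, ?_, ?_⟩
  · rw [← h.closure_eq, hI.closure_eq_closure, h.closure_eq, hE]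
  · rw [h.dim_eq, hI.encard_eq_eRk]

theorem eq_of_subset_of_dim_le (h : IsPregeometry cl) {E F : Set X} (hE : cl E = E)
    (hF : cl F = F) (hEF : E ⊆ F) (hd : dim cl F ≤ dim cl E) (hfin : dim cl E ≠ ⊤) : E = F := by
  rw [h.dim_eq] at hd hfin
  rw [h.dim_eq] at hd
  have := (Matroid.eRk_ne_top_iff.1 hfin).closure_eq_closure_of_subset_of_eRk_ge_eRk hEF hd
  rwa [h.closure_eq, h.closure_eq, hE, hF] at this

/-- Flatness for a family of distinct flats of dimension `n`, when all flats of smaller dimension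
are disintegrated. -/
theorem dim_le_of_isFlat (h : IsPregeometry cl) (hflat : IsFlat cl) {n : ℕ}
    (hsmall : ∀ I, IndepSet cl I → I.encard < n →
      ∀ x ∈ cl I, x ∉ cl ∅ → ∃ a ∈ I, x ∈ cl {a})
    (𝓔 : Finset (Set X)) (hcl : ∀ E ∈ 𝓔, cl E = E) (hdim : ∀ E ∈ 𝓔, dim cl E = n)
    {F : Set X} (hF : ⋃ E ∈ 𝓔, E = F) (hfin : (points cl F).Finite) :
    ((dim cl F).toNat : ℤ) ≤ (points cl F).ncard -
      ∑ E ∈ 𝓔, (((points cl E).ncard : ℤ) - n) := by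
  classical
  let e := 𝓔.equivFin.symm
  let E : Fin 𝓔.card → Set X := fun i => e i
  have hEcl : ∀ i, cl (E i) = E i := fun i => hcl _ (e i).2
  have hEdim : ∀ i, dim cl (E i) = n := fun i => hdim _ (e i).2
  have hEinj : Function.Injective E := Subtype.val_injective.comp e.injective
  have hEU : ⋃ i, E i = F := by
    rw [← hF]
    ext x
    simp only [mem_iUnion, E]
    constructor
    · rintro ⟨i, hi⟩
      exact ⟨_, (e i).2, hi⟩
    · rintro ⟨A, hA, hx⟩
      exact ⟨e.symm ⟨A, hA⟩, by simpa using hx⟩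
  have := hflat.2 _ E fun i => ⟨hEcl i, by rw [hEdim i]; exact ENat.natCast_ne_top n⟩
  rw [h.flatDelta_eq hEcl (hEU ▸ hfin), hEU] at this
  · refine this.trans_eq ?_
    congr 1
    rw [← Finset.sum_coe_sort 𝓔, ← Equiv.sum_comp e]
    refine Finset.sum_congr rfl fun i _ => ?_
    rw [hEdim i]
    rfl
  · intro s hs
    have hG := h.cl_biInter hEcl s
    set G := ⋂ i ∈ s, E i with hGdef
    obtain ⟨I, hI, hIG, hIc⟩ := h.exists_indepSet_cl_eq hG
    -- An intersection of dimension `n` would equal each of its members, but at least two of them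
    -- are distinct.
    have hlt : dim cl G < n := by
      by_contra hle
      push Not at hle
      have key : ∀ i ∈ s, E i = G := by
        intro i hi
        have hsub : G ⊆ E i := biInter_subset_of_mem hi
        refine (h.eq_of_subset_of_dim_le hG (hEcl i) hsub ((hEdim i).le.trans hle) ?_).symm
        rw [h.dim_eq]
        refine ne_top_of_le_ne_top ?_ (h.matroid.eRk_mono hsub)
        rw [← h.dim_eq, hEdim]
        exact ENat.natCast_ne_top n
      obtain ⟨i, hi, j, hj, hij⟩ := Finset.one_lt_card.1 hs
      exact hij (hEinj ((key i hi).trans (key j hj).symm))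
    rw [← hIc, ← h.encard_points_eq hI (hsmall I hI (hIc ▸ hlt)), hIG]

/-- The flats spanned by `R` and one more element of `F`. -/
def blocks (cl : Set X → Set X) (F R : Set X) : Set (Set X) :=
  (fun x => cl (insert x R)) '' (F \ cl R)

/-- A point outside `cl R` lies in the block that it spans together with `R`. Only this covering is
needed, not disjointness of the blocks off `cl R`. -/
theorem ncard_points_le (h : IsPregeometry cl) {F R : Set X} (hF : F.Finite) (hFcl : cl F = F)
    (hR : R ⊆ F) {𝓑 : Finset (Set X)} (h𝓑 : (𝓑 : Set (Set X)) = blocks cl F R) :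
    ((points cl F).ncard : ℤ) ≤ (points cl (cl R)).ncard +
      ∑ E ∈ 𝓑, (((points cl E).ncard : ℤ) - (points cl (cl R)).ncard) := by
  classical
  have hsub : ∀ E ∈ 𝓑, E ⊆ F ∧ cl R ⊆ E := by
    intro E hE
    rw [← Finset.mem_coe, h𝓑] at hE
    obtain ⟨x, hx, rfl⟩ := hE
    exact ⟨(h.mono (insert_subset hx.1 hR)).trans_eq hFcl, h.mono (subset_insert _ _)⟩
  have hfin := h.points_finite hF
  have hRF : cl R ⊆ F := (h.mono hR).trans_eq hFcl
  have hfR := hfin.subset (points_mono (cl := cl) hRF)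
  have h1 : points cl F ⊆ points cl (cl R) ∪ ⋃ E ∈ 𝓑, (points cl E \ points cl (cl R)) := by
    intro P hP
    by_cases hPR : P ∈ points cl (cl R)
    · exact Or.inl hPR
    · right
      obtain ⟨⟨x, hx, rfl⟩, hPF⟩ := hP
      have hxF := hPF (h.mem_cl_singleton x)
      have hxR : x ∉ cl R := fun hc => hPR ⟨⟨x, hx, rfl⟩, h.cl_singleton_subset (h.idem R) hc⟩
      refine mem_biUnion (x := cl (insert x R)) ?_ ⟨⟨⟨x, hx, rfl⟩, ?_⟩, hPR⟩
      · rw [h𝓑]; exact ⟨x, ⟨hxF, hxR⟩, rfl⟩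
      · exact h.mono (singleton_subset_iff.2 (mem_insert _ _))
  have h2 : (points cl F).ncard ≤ (points cl (cl R)).ncard +
      ∑ E ∈ 𝓑, (points cl E \ points cl (cl R)).ncard := by
    have hfU : (⋃ E ∈ 𝓑, (points cl E \ points cl (cl R))).Finite :=
      𝓑.finite_toSet.biUnion fun E hE =>
        (hfin.subset (points_mono (hsub E hE).1)).subset sdiff_subset
    refine (ncard_le_ncard h1 (hfR.union hfU)).trans ((ncard_union_le _ _).trans ?_)
    gcongr
    exact Finset.set_ncard_biUnion_le _ _
  refine (Int.ofNat_le.2 h2).trans_eq ?_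
  push_cast
  congr 1
  refine Finset.sum_congr rfl fun E hE => ?_
  have := ncard_sdiff_add_ncard_of_subset (points_mono (cl := cl) (hsub E hE).2)
    (hfin.subset (points_mono (hsub E hE).1))
  omega

/-- Here `n = m + 1`. Flatness is applied to the blocks through `R` together with those through
`R'`. The former nearly exhaust the bound, each further block lowers it by at least one, and the two
families share at most one block. The symmetry between `R` and `R'` makes `hle` harmless. -/
theorem infinite_cl_aux (h : IsPregeometry cl) (hflat : IsFlat cl) {m : ℕ}
    (hsmall : ∀ I, IndepSet cl I → I.encard < (m + 1 : ℕ) →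
      ∀ x ∈ cl I, x ∉ cl ∅ → ∃ a ∈ I, x ∈ cl {a})
    (hlarge : ∀ I, IndepSet cl I → I.encard = (m + 1 : ℕ) →
      ∃ d ∈ cl I, d ∉ cl ∅ ∧ ∀ a ∈ I, d ∉ cl {a})
    {F R R' : Set X} (hF : F.Finite) (hFcl : cl F = F) (hdimF : dim cl F = (m + 2 : ℕ))
    (hRF : R ⊆ F) (hRF' : R' ⊆ F) (hR : IndepSet cl R) (hR' : IndepSet cl R')
    (hRc : R.encard = m) (hRc' : R'.encard = m) (hRR' : IndepSet cl (R ∪ R'))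
    (hRRc : (R ∪ R').encard = (m + 1 : ℕ))
    (hle : (blocks cl F R).ncard ≤ (blocks cl F R').ncard) : False := by
  classical
  have hfin : ∀ R : Set X, (blocks cl F R).Finite := fun R => (hF.subset sdiff_subset).image _
  obtain ⟨𝓑, h𝓑⟩ := (hfin R).exists_finset_coe
  obtain ⟨𝓑', h𝓑'⟩ := (hfin R').exists_finset_coe
  have hspan : ∀ {R : Set X}, IndepSet cl R → R.encard = m → R ⊆ F → ∀ E ∈ blocks cl F R,
      ∃ J, IndepSet cl J ∧ J.encard = (m + 1 : ℕ) ∧ R ⊆ J ∧ J ⊆ F ∧ E = cl J := by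
    rintro R hR hRc hRF _ ⟨x, hx, rfl⟩
    refine ⟨insert x R, h.indepSet_insert hR hx.2, ?_, subset_insert _ _,
      insert_subset hx.1 hRF, rfl⟩
    rw [encard_insert_of_notMem fun hc => hx.2 (h.subset _ hc), hRc]
    rfl
  have hspanU : ∀ E ∈ 𝓑 ∪ 𝓑',
      ∃ J, IndepSet cl J ∧ J.encard = (m + 1 : ℕ) ∧ J ⊆ F ∧ E = cl J := by
    intro E hE
    rcases Finset.mem_union.1 hE with hE | hE
    · obtain ⟨J, h1, h2, -, h3⟩ := hspan hR hRc hRF E (h𝓑 ▸ Finset.mem_coe.2 hE)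
      exact ⟨J, h1, h2, h3⟩
    · obtain ⟨J, h1, h2, -, h3⟩ := hspan hR' hRc' hRF' E (h𝓑' ▸ Finset.mem_coe.2 hE)
      exact ⟨J, h1, h2, h3⟩
  have hUcl : ∀ E ∈ 𝓑 ∪ 𝓑', cl E = E := by
    intro E hE
    obtain ⟨J, -, -, -, rfl⟩ := hspanU E hE
    exact h.idem J
  have hUdim : ∀ E ∈ 𝓑 ∪ 𝓑', dim cl E = (m + 1 : ℕ) := by
    intro E hE
    obtain ⟨J, hJ, hJc, -, rfl⟩ := hspanU E hE
    rw [h.dim_cl_of_indepSet hJ, hJc]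
  have hUF : ∀ E ∈ 𝓑 ∪ 𝓑', E ⊆ F := by
    intro E hE
    obtain ⟨J, -, -, hJF, rfl⟩ := hspanU E hE
    exact (h.mono hJF).trans_eq hFcl
  -- One more than the dimension: the `m + 1` points of a basis and the extra one given by `hlarge`.
  have hUpts : ∀ E ∈ 𝓑 ∪ 𝓑', m + 2 ≤ (points cl E).ncard := by
    intro E hE
    have hfE := h.points_finite (hF.subset (hUF E hE))
    obtain ⟨J, hJ, hJc, -, rfl⟩ := hspanU E hE
    obtain ⟨d, hd, hd₀, hda⟩ := hlarge J hJ hJc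
    have := h.lt_encard_points hJ hd hd₀ hda
    rw [hJc, ← hfE.cast_ncard_eq] at this
    exact_mod_cast this
  have hptsR : (points cl (cl R)).ncard = m := by
    rw [Set.ncard, h.encard_points_eq hR (hsmall R hR (by rw [hRc]; exact_mod_cast m.lt_succ_self)),
      hRc]
    rfl
  have hUnion : ⋃ E ∈ 𝓑 ∪ 𝓑', E = F := by
    refine Subset.antisymm (iUnion₂_subset hUF) ?_
    -- Some block must exist in order to cover `cl R` itself.
    have hxF : ∃ x ∈ F, x ∉ cl R := by
      by_contra! hc
      have : dim cl F ≤ dim cl (cl R) := by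
        rw [h.dim_eq, h.dim_eq]
        exact h.matroid.eRk_mono hc
      rw [h.dim_cl_of_indepSet hR, hdimF, hRc] at this
      have := Nat.cast_le.1 this
      omega
    have hblock : ∀ x ∈ F, x ∉ cl R → cl (insert x R) ∈ 𝓑 ∪ 𝓑' := fun x hx hxR =>
      Finset.mem_union_left _ (by rw [← Finset.mem_coe, h𝓑]; exact ⟨x, ⟨hx, hxR⟩, rfl⟩)
    intro x hx
    by_cases hxR : x ∈ cl R
    · obtain ⟨y, hy, hyR⟩ := hxF
      exact mem_biUnion (hblock y hy hyR) (h.mono (subset_insert _ _) hxR)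
    · exact mem_biUnion (hblock x hx hxR) (h.subset _ (mem_insert _ _))
  -- A common block contains `R ∪ R'`, which already spans its dimension `m + 1`.
  have hinter : (𝓑 ∩ 𝓑').card ≤ 1 := by
    have key : ∀ E ∈ 𝓑 ∩ 𝓑', cl (R ∪ R') = E := by
      intro E hE
      obtain ⟨hE1, hE2⟩ := Finset.mem_inter.1 hE
      have hEU := Finset.mem_union_left 𝓑' hE1
      obtain ⟨J, -, -, hRJ, -, rfl⟩ := hspan hR hRc hRF E (h𝓑 ▸ Finset.mem_coe.2 hE1)
      obtain ⟨J', -, -, hRJ', -, hJJ'⟩ := hspan hR' hRc' hRF' _ (h𝓑' ▸ Finset.mem_coe.2 hE2)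
      refine h.eq_of_subset_of_dim_le (h.idem _) (h.idem _)
        (h.cl_subset_cl (union_subset (hRJ.trans (h.subset _)) ?_)) ?_ ?_
      · rw [hJJ']; exact hRJ'.trans (h.subset _)
      · rw [hUdim _ hEU, h.dim_cl_of_indepSet hRR', hRRc]
      · rw [h.dim_cl_of_indepSet hRR', hRRc]; exact ENat.natCast_ne_top _
    exact Finset.card_le_one.2 fun E hE E' hE' => (key E hE).symm.trans (key E' hE')
  have hmain := h.dim_le_of_isFlat hflat hsmall (𝓑 ∪ 𝓑') hUcl hUdim hUnion (h.points_finite hF)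
  have hpts := h.ncard_points_le hF hFcl hRF h𝓑
  rw [hptsR] at hpts
  rw [hdimF, ENat.toNat_natCast, ← Finset.union_sdiff_self_eq_union,
    Finset.sum_union Finset.disjoint_sdiff] at hmain
  have hs1 : ∑ E ∈ 𝓑, (((points cl E).ncard : ℤ) - m) =
      ∑ E ∈ 𝓑, (((points cl E).ncard : ℤ) - (m + 1 : ℕ)) + 𝓑.card := by
    rw [Finset.card_eq_sum_ones, Nat.cast_sum, ← Finset.sum_add_distrib]
    refine Finset.sum_congr rfl fun E _ => ?_
    push_cast
    ring
  have hs2 : ((𝓑' \ 𝓑).card : ℤ) ≤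
      ∑ E ∈ 𝓑' \ 𝓑, (((points cl E).ncard : ℤ) - (m + 1 : ℕ)) := by
    rw [Finset.card_eq_sum_ones, Nat.cast_sum]
    refine Finset.sum_le_sum fun E hE => ?_
    have := hUpts E (Finset.mem_union_right _ (Finset.mem_sdiff.1 hE).1)
    push_cast
    omega
  have hc : (𝓑' \ 𝓑).card + (𝓑 ∩ 𝓑').card = 𝓑'.card := by
    rw [Finset.inter_comm]
    exact Finset.card_sdiff_add_card_inter 𝓑' 𝓑
  rw [← h𝓑, ← h𝓑', ncard_coe_finset, ncard_coe_finset] at hle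
  -- Altogether `m + 2 ≤ m + ∑_𝓑 (|E| - m) - ∑_𝓑 (|E| - m - 1) - (|𝓑'| - 1) = m + 1 + |𝓑| - |𝓑'| ≤ m
  -- + 1`.
  push_cast at *
  omega

/-- In a flat pregeometry where flats of dimension less than `n` are disintegrated and those of
dimension `n` are not, flats of dimension `n + 1` are infinite. -/
theorem infinite_cl_of_isFlat (h : IsPregeometry cl) (hflat : IsFlat cl) {n : ℕ} (hn : 2 ≤ n)
    (hsmall : ∀ I, IndepSet cl I → I.encard < n →
      ∀ x ∈ cl I, x ∉ cl ∅ → ∃ a ∈ I, x ∈ cl {a})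
    (hlarge : ∀ I, IndepSet cl I → I.encard = n →
      ∃ d ∈ cl I, d ∉ cl ∅ ∧ ∀ a ∈ I, d ∉ cl {a})
    {B : Set X} (hB : IndepSet cl B) (hBc : B.encard = (n + 1 : ℕ)) : (cl B).Infinite := by
  classical
  intro hF
  obtain ⟨m, rfl⟩ : ∃ m, n = m + 1 := ⟨n - 1, by omega⟩
  have hdim : dim cl (cl B) = (m + 2 : ℕ) := by rw [h.dim_cl_of_indepSet hB, hBc]
  obtain ⟨C, hCB, hCc⟩ := exists_subset_encard_eq (s := B) (k := (m + 1 : ℕ))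
    (by rw [hBc]; exact_mod_cast Nat.le_succ _)
  have hCcard : 1 < C.encard := by rw [hCc]; exact_mod_cast (by omega : 1 < m + 1)
  -- `R` and `R'` will be `C \ {p}` and `C \ {q}`, whose union is `C`; two distinct elements exist
  -- because `n ≥ 2`.
  obtain ⟨p, q, hp, hq, hpq⟩ := one_lt_encard_iff.1 hCcard
  have hC := h.indepSet_subset hB hCB
  have hsub : ∀ p, C \ {p} ⊆ cl B := fun p => (sdiff_subset.trans hCB).trans (h.subset B)
  have hind : ∀ p, IndepSet cl (C \ {p}) := fun p => h.indepSet_subset hC sdiff_subset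
  have hcard : ∀ p ∈ C, (C \ {p}).encard = m := by
    intro p hp
    have := encard_sdiff_singleton_add_one hp
    have hf : (C \ {p}).Finite := (finite_of_encard_eq_coe hCc).subset sdiff_subset
    rw [hCc, ← hf.cast_ncard_eq] at this
    rw [← hf.cast_ncard_eq]
    have : (C \ {p}).ncard + 1 = m + 1 := by exact_mod_cast this
    exact_mod_cast (by omega : (C \ {p}).ncard = m)
  have hun : ∀ p q, p ≠ q → C \ {p} ∪ C \ {q} = C := by
    intro p q hpq
    ext x
    simp only [mem_union, mem_sdiff, mem_singleton_iff]
    grind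
  have key : ∀ p ∈ C, ∀ q ∈ C, p ≠ q →
      ¬ (blocks cl (cl B) (C \ {p})).ncard ≤ (blocks cl (cl B) (C \ {q})).ncard :=
    fun p hp q hq hpq => h.infinite_cl_aux hflat hsmall hlarge hF (h.idem B) hdim (hsub p)
      (hsub q) (hind p) (hind q) (hcard p hp) (hcard q hq) ((hun p q hpq).symm ▸ hC)
      ((hun p q hpq).symm ▸ hCc)
  rcases le_total (blocks cl (cl B) (C \ {p})).ncard (blocks cl (cl B) (C \ {q})).ncard with hl | hl
  · exact key p hp q hq hpq hl
  · exact key q hq p hp hpq.symm hl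

end IsPregeometry

end Points

/-! ### Circuits and failures of disintegration -/

section Circuits

open Set

variable {X : Type*} {cl : Set X → Set X}

namespace IsPregeometry

theorem indepTuple_iff (h : IsPregeometry cl) {ι : Type*} {a : ι → X} :
    IndepTuple cl a ↔ Function.Injective a ∧ IndepSet cl (range a) := by
  constructor
  · intro ha
    have hinj : Function.Injective a := by
      intro i j hij
      by_contra hne
      exact ha i (h.subset _ ⟨j, fun e => hne e.symm, hij.symm⟩)
    refine ⟨hinj, ?_⟩
    rintro _ ⟨i, rfl⟩ hc
    refine ha i (h.mono ?_ hc)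
    rintro _ ⟨⟨j, rfl⟩, hj⟩
    exact ⟨j, fun e => hj (by rw [e]; rfl), rfl⟩
  · rintro ⟨hinj, ha⟩ i hc
    refine ha (a i) (mem_range_self i) (h.mono ?_ hc)
    rintro _ ⟨j, hj, rfl⟩
    exact ⟨mem_range_self j, fun e => hj (hinj e)⟩

/-- For `I ⊆ A` of least size with `x ∈ cl I`, the set `insert x I` is a circuit; `I` has at least
two elements because no single element of `A` captures `x`. -/
theorem exists_isCircuit (h : IsPregeometry cl) {A : Set X} (hA : A.Nonempty) {x : X}
    (hx : x ∈ cl A) (hxA : ∀ a ∈ A, x ∉ cl {a}) :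
    ∃ m : ℕ, 2 < m ∧ (m : ℕ∞) ≤ A.encard + 1 ∧ ∃ a : Fin m → X, IsCircuit cl a := by
  classical
  obtain ⟨A₀, hA₀, hfin, hxA₀⟩ := h.finitary hx
  obtain ⟨I, ⟨hIA, hIfin, hxI⟩, hmin⟩ := exists_minimalFor_of_wellFoundedLT
    (fun C : Set X => C ⊆ A ∧ C.Finite ∧ x ∈ cl C) Set.ncard ⟨A₀, hA₀, hfin, hxA₀⟩
  have hproper : ∀ y ∈ I, x ∉ cl (I \ {y}) := by
    intro y hy hc
    have h1 := ncard_sdiff_singleton_lt_of_mem hy hIfin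
    have h2 := hmin (j := I \ {y}) ⟨sdiff_subset.trans hIA, hIfin.subset sdiff_subset, hc⟩ h1.le
    omega
  have hxI' : x ∉ I := fun hc => hxA x (hIA hc) (h.mem_cl_singleton x)
  have hI : IndepSet cl I := by
    intro i hi hc
    refine hproper i hi (h.cl_subset_cl (fun z hz => ?_) hxI)
    by_cases e : z = i
    · exact e ▸ hc
    · exact h.subset _ ⟨hz, e⟩
  have hsub : ∀ y ∈ insert x I, IndepSet cl (insert x I \ {y}) := by
    rintro y (rfl | hy)
    · exact h.indepSet_subset hI (by simp)
    · rw [← insert_sdiff_singleton_comm (fun e : x = y => hxI' (e ▸ hy))]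
      exact h.indepSet_insert (h.indepSet_subset hI sdiff_subset) (hproper y hy)
  have hcard : (insert x I).ncard = I.ncard + 1 := ncard_insert_of_notMem hxI' hIfin
  have hIcard : 2 ≤ I.ncard := by
    by_contra! hlt
    have h01 : I.ncard ≤ 1 := by omega
    rcases (ncard_le_one_iff_eq hIfin).1 h01 with rfl | ⟨a, rfl⟩
    · obtain ⟨a, ha⟩ := hA
      exact hxA a ha (h.mono (empty_subset _) hxI)
    · exact hxA a (hIA rfl) hxI
  have := (hIfin.insert x).to_subtype
  let e := (Finite.equivFinOfCardEq (show Nat.card ↥(insert x I) = I.ncard + 1 from hcard)).symm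
  refine ⟨I.ncard + 1, by omega, ?_, fun i => e i, ?_, ?_⟩
  · push_cast
    rw [hIfin.cast_ncard_eq]
    gcongr
  · intro hind
    have hr : range (fun i => (e i : X)) = insert x I := by
      ext y
      constructor
      · rintro ⟨i, rfl⟩
        exact (e i).2
      · intro hy
        exact ⟨e.symm ⟨y, hy⟩, by simp⟩
    have := (h.indepTuple_iff.1 hind).2
    rw [hr] at this
    exact this x (mem_insert _ _) (by simpa [hxI'] using hxI)
  · intro J hJ
    obtain ⟨j, hj⟩ := (ne_univ_iff_exists_notMem J).1 hJ
    have hinj : Function.Injective (fun i => (e i : X)) := Subtype.val_injective.comp e.injective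
    refine h.indepTuple_iff.2 ⟨fun i i' hii => Subtype.ext (hinj hii),
      h.indepSet_subset (hsub (e j) (e j).2) ?_⟩
    rintro _ ⟨i, rfl⟩
    refine ⟨(e i).2, fun hc => hj ?_⟩
    have : (i : Fin _) = j := hinj hc
    exact this ▸ i.2

theorem indepTuple_init_of_isCircuit (h : IsPregeometry cl) {n : ℕ} (hn : 2 ≤ n) {a : Fin (n + 1) → X}
    (ha : IsCircuit cl a) : IndepTuple cl (fun i : Fin n => a i.castSucc) ∧
      a (Fin.last n) ∈ cl (range fun i : Fin n => a i.castSucc) ∧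
      ∀ i : Fin n, a (Fin.last n) ∉ cl {a i.castSucc} := by
  have hsub := h.indepTuple_iff.1 (ha.2 {j | j ≠ Fin.last n}
    ((ne_univ_iff_exists_notMem _).2 ⟨Fin.last n, by simp⟩))
  have hr : range (fun j : {j | j ≠ Fin.last n} => a j) =
      range fun i : Fin n => a i.castSucc := by
    ext y
    constructor
    · rintro ⟨⟨j, hj⟩, rfl⟩
      obtain ⟨i, rfl⟩ := Fin.exists_castSucc_eq.2 hj
      exact ⟨i, rfl⟩
    · rintro ⟨i, rfl⟩
      exact ⟨⟨i.castSucc, Fin.castSucc_ne_last i⟩, rfl⟩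
  have hinj : Function.Injective (fun i : Fin n => a i.castSucc) := by
    intro i j hij
    have := @hsub.1 ⟨i.castSucc, Fin.castSucc_ne_last i⟩ ⟨j.castSucc, Fin.castSucc_ne_last j⟩ hij
    exact Fin.castSucc_injective n (congrArg Subtype.val this)
  rw [hr] at hsub
  have hne : ∀ i : Fin n, a (Fin.last n) ∉ cl {a i.castSucc} := by
    intro i hc
    -- Since `n + 1 ≥ 3`, a pair is a proper subtuple of the circuit and hence independent.
    have hJ : ({i.castSucc, Fin.last n} : Set (Fin (n + 1))) ≠ Set.univ := by
      intro hJ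
      have h1 : (Set.univ : Set (Fin (n + 1))).ncard ≤ 2 := by
        rw [← hJ]
        exact (ncard_insert_le _ _).trans (by rw [ncard_singleton])
      rw [ncard_univ, Nat.card_eq_fintype_card, Fintype.card_fin] at h1
      omega
    refine ha.2 _ hJ ⟨Fin.last n, by simp⟩ (h.mono ?_ hc)
    rintro _ rfl
    exact ⟨⟨i.castSucc, by simp⟩, fun e => Fin.castSucc_ne_last i (congrArg Subtype.val e), rfl⟩
  refine ⟨h.indepTuple_iff.2 ⟨hinj, hsub.2⟩, ?_, hne⟩
  by_contra hc
  have hins := h.indepSet_insert hsub.2 hc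
  refine ha.1 (h.indepTuple_iff.2 ⟨?_, h.indepSet_subset hins ?_⟩)
  · intro i j hij
    induction i using Fin.lastCases with
    | last =>
      induction j using Fin.lastCases with
      | last => rfl
      | cast j => exact (hc (h.subset _ ⟨j, hij.symm⟩)).elim
    | cast i =>
      induction j using Fin.lastCases with
      | last => exact (hc (h.subset _ ⟨i, hij⟩)).elim
      | cast j => exact congrArg _ (hinj hij)
  · rintro _ ⟨i, rfl⟩
    induction i using Fin.lastCases with
    | last => exact mem_insert _ _
    | cast i => exact mem_insert_of_mem _ ⟨i, rfl⟩

end IsPregeometry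

end Circuits

/-! ### Independent tuples of equal length have the same type -/

section Homogeneity

open Set FirstOrder.Language

variable {L : FirstOrder.Language.{u, v}} {M : Type w} [L.Structure M]

/-- In a minimal structure all independent tuples of the same length have the same type. -/
theorem mem_of_mem_of_indepTuple (hM : IsMinimalStructure L M) {n : ℕ} {a c : Fin n → M}
    (ha : IndepTuple (acl L M) a) (hc : IndepTuple (acl L M) c) {D : Set (Fin n → M)}
    (hD : (∅ : Set M).Definable L D) (haD : a ∈ D) : c ∈ D := by
  induction n with
  | zero => rwa [Subsingleton.elim c a]
  | succ n ih =>
    have hlast : ∀ {b : Fin (n + 1) → M}, IndepTuple (acl L M) b →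
        b (Fin.last n) ∉ acl L M (range fun i : Fin n => b i.castSucc) := by
      intro b hb h
      refine hb (Fin.last n) (acl_mono ?_ h)
      rintro _ ⟨i, rfl⟩
      exact ⟨i.castSucc, Fin.castSucc_ne_last i, rfl⟩
    have hinit : ∀ {b : Fin (n + 1) → M}, IndepTuple (acl L M) b →
        IndepTuple (acl L M) fun i : Fin n => b i.castSucc := by
      intro b hb i h
      refine hb i.castSucc (acl_mono ?_ h)
      rintro _ ⟨j, hj, rfl⟩
      exact ⟨j.castSucc, fun e => hj (Fin.castSucc_injective n e), rfl⟩
    let D' : Set (Fin n ⊕ Fin 1 → M) := {w | w ∘ finSumFinEquiv.symm ∈ D}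
    have hD' : (∅ : Set M).Definable L D' := hD.preimage_comp _
    have hmem : ∀ b : Fin (n + 1) → M,
        b (Fin.last n) ∈ fiber D' (fun i : Fin n => b i.castSucc) ↔ b ∈ D := by
      intro b
      rw [mem_fiber]
      refine iff_of_eq (congrArg (· ∈ D) ?_)
      ext i
      induction i using Fin.lastCases with
      | last => simp
      | cast i =>
        have : finSumFinEquiv.symm i.castSucc = (Sum.inl i : Fin n ⊕ Fin 1) := by
          rw [Equiv.symm_apply_eq]; rfl
        simp [this]
    have hfin : ∀ {E : Set (Fin n ⊕ Fin 1 → M)}, (∅ : Set M).Definable L E →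
        ∀ {b : Fin (n + 1) → M}, IndepTuple (acl L M) b →
        b (Fin.last n) ∈ fiber E (fun i : Fin n => b i.castSucc) →
        ¬ (fiber E (fun i : Fin n => b i.castSucc)).Finite := fun hE b hb hbE hf =>
      hlast hb (mem_acl_of_mem_fiber hE (empty_subset _) (fun i => mem_range_self i) hf hbE)
    -- The last entry is generic over the others, so membership in `D` means that the fibre is
    -- cofinite. A bound `k` on its complement is a definable condition on the initial tuple, which
    -- the induction transfers.
    have hcof : (fiber D'ᶜ (fun i : Fin n => a i.castSucc)).Finite :=
      (hM.2 _ (definable_fiber (B := Set.univ) hD' (subset_univ _)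
        (fun _ => mem_univ _))).resolve_left (hfin hD' ha ((hmem a).2 haD))
    obtain ⟨k, hk⟩ := hcof.exists_encard_eq_coe
    have hck := ih (hinit ha) (hinit hc) (definable_encard_fiber_le hD'.compl k) hk.le
    rw [← hmem]
    by_contra hcD
    exact hfin hD'.compl hc hcD (finite_of_encard_le_coe hck)

/-- Otherwise the finite fibre over `c` is covered by finitely many sets, each finite and definable
from one entry of `c`. The covering and the size bounds are definable without parameters, so they
hold at `a` as well and make `d` algebraic over a single `a i`. -/
theorem exists_mem_acl_of_indepTuple (hM : IsMinimalStructure L M) {n : ℕ} {a c : Fin n → M}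
    (ha : IndepTuple (acl L M) a) (hc : IndepTuple (acl L M) c) {d : M}
    (hd : d ∈ acl L M (range a)) (hda : ∀ i, d ∉ acl L M {a i}) :
    ∃ e ∈ acl L M (range c), ∀ i, e ∉ acl L M {c i} := by
  by_contra! hcon
  obtain ⟨D, hD, hDa, hdD⟩ := exists_fiber_of_mem_acl (A := ∅) a (by simpa using hd)
  obtain ⟨k, hk⟩ := hDa.exists_encard_eq_coe
  have hck := mem_of_mem_of_indepTuple hM ha hc (definable_encard_fiber_le hD k) hk.le
  have hDc : (fiber D c).Finite := finite_of_encard_le_coe hck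
  have hex : ∀ x : fiber D c, ∃ (i : Fin n) (S : Set (Fin 1 ⊕ Fin 1 → M)) (l : ℕ),
      (∅ : Set M).Definable L S ∧ (fiber S (fun _ => c i)).encard ≤ l ∧
        (x : M) ∈ fiber S (fun _ => c i) := by
    intro x
    obtain ⟨i, hi⟩ := hcon x
      (mem_acl_of_mem_fiber hD (empty_subset _) (fun i => mem_range_self i) hDc x.2)
    obtain ⟨S, hS, hSf, hxS⟩ := exists_fiber_of_mem_acl (A := ∅) (fun _ : Fin 1 => c i)
      (by simpa using hi)
    obtain ⟨l, hl⟩ := hSf.exists_encard_eq_coe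
    exact ⟨i, S, l, hS, hl.le, hxS⟩
  choose i S l hS hl hxS using hex
  have := hDc.to_subtype
  have hZ1 : (∅ : Set M).Definable L {v : Fin n → M | ∀ u : Fin 1 → M, Sum.elim v u ∈
      Dᶜ ∪ ⋃ x, {w | w ∘ Sum.map (fun _ : Fin 1 => i x) id ∈ S x}} :=
    (hD.compl.union (definable_iUnion_of_finite fun x => (hS x).preimage_comp _)).forall_of_finite
  have hZ2 : (∅ : Set M).Definable L (⋂ x, {v : Fin n → M |
      (fiber (S x) (v ∘ fun _ : Fin 1 => i x)).encard ≤ l x}) :=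
    definable_iInter_of_finite fun x =>
      (definable_encard_fiber_le (hS x) (l x)).preimage_comp (fun _ : Fin 1 => i x)
  have helim : ∀ (v : Fin n → M) (y : M) x, Sum.elim v (fun _ : Fin 1 => y) ∘
      Sum.map (fun _ : Fin 1 => i x) id = Sum.elim (fun _ => v (i x)) (fun _ : Fin 1 => y) := by
    intro v y x
    ext (j | j) <;> rfl
  have hcZ : c ∈ {v : Fin n → M | ∀ u : Fin 1 → M, Sum.elim v u ∈
      Dᶜ ∪ ⋃ x, {w | w ∘ Sum.map (fun _ : Fin 1 => i x) id ∈ S x}} := by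
    intro u
    have hu : u = fun _ => u 0 := by ext j; rw [Subsingleton.elim j 0]
    rw [hu]
    by_cases hx : u 0 ∈ fiber D c
    · refine Or.inr (mem_iUnion.2 ⟨⟨u 0, hx⟩, ?_⟩)
      rw [mem_ofPred_eq, helim]
      exact hxS ⟨u 0, hx⟩
    · exact Or.inl hx
  have haZ1 := mem_of_mem_of_indepTuple hM hc ha hZ1 hcZ
  have haZ2 := mem_of_mem_of_indepTuple hM hc ha hZ2 (mem_iInter.2 fun x => hl x)
  rcases haZ1 fun _ => d with h | h
  · exact h hdD
  · obtain ⟨x, hx⟩ := mem_iUnion.1 h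
    rw [mem_ofPred_eq, helim] at hx
    exact hda (i x) (mem_acl_of_mem_fiber (hS x) (empty_subset _)
      (fun _ => mem_singleton _)
      (finite_of_encard_le_coe (mem_iInter.1 haZ2 x)) hx)

end Homogeneity

/-! ### Closed sets as elementary substructures, and the prime model -/

section Models

open Set FirstOrder.Language

variable {L : FirstOrder.Language.{u, v}} {M : Type w} [L.Structure M]

theorem mem_acl_of_map_mem_acl {P : Type*} [L.Structure P] (f : P ↪ₑ[L] M) {A : Set P} {b : P}
    (hb : f b ∈ acl L M (f '' A)) : b ∈ acl L P A := by
  have hr : f '' A = ∅ ∪ range fun a : A => f a := by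
    rw [empty_union]
    ext y
    simp
  rw [hr] at hb
  obtain ⟨D, hD, hfin, hbD⟩ := exists_fiber_of_mem_acl _ hb
  obtain ⟨φ, rfl⟩ := empty_definable_iff.1 hD
  have hpre : fiber (Set.ofPred φ.Realize) (fun a : A => (a : P)) =
      f ⁻¹' fiber (Set.ofPred φ.Realize) (fun a : A => f a) := by
    ext x
    rw [mem_preimage, mem_fiber, mem_fiber, mem_ofPred_eq, mem_ofPred_eq, ← f.map_formula]
    refine iff_of_eq (congrArg φ.Realize ?_)
    ext (a | j) <;> rfl
  refine mem_acl_of_mem_fiber (A := ∅) (empty_definable_iff.2 ⟨φ, rfl⟩) (empty_subset _)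
    (c := fun a : A => (a : P)) (fun a => a.2) ?_ ?_
  · rw [hpre]
    exact hfin.preimage f.injective.injOn
  · rw [hpre]
    exact hbD

/-- An infinite algebraically closed subset of a minimal structure is an elementary substructure. -/
theorem meetsDefinable_of_acl_eq (hM : IsMinimalStructure L M) {A : Set M}
    (hA : acl L M A = A) (hinf : A.Infinite) : L.MeetsDefinable A := by
  intro D hne hD
  rcases hM.2 D (Definable.mono hD (subset_univ _)) with hf | hf
  · obtain ⟨x, hx⟩ := hne
    exact ⟨x, hx, hA ▸ ⟨D, hD, hf, hx⟩⟩
  · obtain ⟨x, hx, hxD⟩ := hinf.exists_notMem_finite hf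
    exact ⟨x, not_not.1 hxD, hx⟩

theorem IsStronglyMinimal.isMinimalStructure {T : L.Theory} (hT : IsStronglyMinimal.{u, v, w} T)
    [Nonempty M] (hM : M ⊨ T) : IsMinimalStructure L M :=
  hT.2 (Theory.ModelType.of T M)

/-- Elementary embeddings preserve independence, so a basis of `P` maps to an independent subset of
`acl B`. -/
theorem dim_univ_le {P : Type*} [L.Structure P] (hM : IsMinimalStructure L M)
    (hP : IsMinimalStructure L P) (f : P ↪ₑ[L] M) {B : Set M} (hB : ∀ x, f x ∈ acl L M B) :
    dim (acl L P) Set.univ ≤ B.encard := by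
  have hp := isPregeometry_acl hP
  have h := isPregeometry_acl hM
  obtain ⟨Y, hY⟩ := hp.matroid.exists_isBasis Set.univ (hp.subset_ground _)
  have hind : IndepSet (acl L M) (f '' Y) := by
    rintro _ ⟨y, hy, rfl⟩ hc
    refine hp.matroid_indep.1 hY.indep y hy (mem_acl_of_map_mem_acl f ?_)
    rwa [image_sdiff f.injective, image_singleton]
  rw [hp.dim_eq, ← hY.encard_eq_eRk, ← f.injective.encard_image,
    ← (h.matroid_indep.2 hind).eRk_eq_encard]
  refine le_trans (h.matroid.eRk_mono (show f '' Y ⊆ acl L M B from ?_)) ?_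
  · rintro _ ⟨y, -, rfl⟩
    exact hB y
  · rw [← h.closure_eq, Matroid.eRk_closure_eq]
    exact h.matroid.eRk_le_encard B

theorem exists_elementaryEmbedding_acl {T : L.Theory} (hT : IsStronglyMinimal.{u, v, w} T)
    [Nonempty M] (hM : M ⊨ T) {P : Type w} [L.Structure P] (hP : IsPrimeModel T P) {k : ℕ}
    (hinf : ∀ B, IndepSet (acl L M) B → B.encard = k → (acl L M B).Infinite) :
    ∃ (B : Set M) (f : P ↪ₑ[L] M), B.encard ≤ k ∧ ∀ x, f x ∈ acl L M B := by
  have hmin := hT.isMinimalStructure hM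
  have h := isPregeometry_acl hmin
  obtain ⟨I, hI⟩ := h.matroid.exists_isBasis Set.univ (h.subset_ground _)
  -- If `M` has dimension at most `k`, its own basis serves as `B`; otherwise `k` elements of the
  -- basis span an elementary substructure, into which `P` embeds.
  rcases le_total I.encard k with hle | hle
  · obtain ⟨f⟩ := hP.2 (Theory.ModelType.of T M)
    refine ⟨I, f, hle, fun x => ?_⟩
    rw [← h.closure_eq]
    exact hI.subset_closure (mem_univ _)
  · obtain ⟨B, hBI, hBc⟩ := exists_subset_encard_eq hle
    have hB : IndepSet (acl L M) B := h.indepSet_subset (h.matroid_indep.1 hI.indep) hBI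
    have hmeet := meetsDefinable_of_acl_eq hmin (h.idem B) (hinf B hB hBc)
    obtain ⟨(f : P ↪ₑ[L] hmeet.toElementarySubstructure)⟩ :=
      hP.2 (Theory.ModelType.of T hmeet.toElementarySubstructure)
    refine ⟨B, hmeet.toElementarySubstructure.subtype.comp f, hBc.le, fun x => ?_⟩
    have hx : (f x : M) ∈ (Substructure.closure L (acl L M B) : Set M) := (f x).2
    rwa [hmeet.closure_eq_self] at hx

end Models

end FlatSM

/-! ### The smallest circuit and the bound on the prime model -/

theorem mainTheorem11 {L : FirstOrder.Language.{u, v}} [Countable L.Symbols]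
    (T : L.Theory) (hT : FlatSM.IsStronglyMinimal.{u, v, w} T)
    (M : Type w) [L.Structure M] [Nonempty M] [Countable M] (hM : M ⊨ T)
    (hsat : FlatSM.IsSaturated L M) (hflat : FlatSM.IsFlat (FlatSM.acl L M))
    (P : Type w) [L.Structure P] [Nonempty P] (hP : FlatSM.IsPrimeModel T P) :
    ∃ n : ℕ,
      IsLeast {m : ℕ | 2 < m ∧ ∃ a : Fin m → M, FlatSM.IsCircuit (FlatSM.acl L M) a} (n + 1) ∧
      FlatSM.dim (FlatSM.acl L P) Set.univ ≤ (n : ℕ∞) + 1 := by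
  have hmin := hT.isMinimalStructure hM
  have h := FlatSM.isPregeometry_acl hmin
  have hne : {m : ℕ | 2 < m ∧ ∃ a : Fin m → M, FlatSM.IsCircuit (FlatSM.acl L M) a}.Nonempty := by
    have := hflat.1
    simp only [FlatSM.IsDisintegrated] at this
    push Not at this
    obtain ⟨A, hA, b, hb, hbA⟩ := this
    obtain ⟨m, hm, -, hm'⟩ := h.exists_isCircuit hA hb hbA
    exact ⟨m, hm, hm'⟩
  obtain ⟨m, hm⟩ : ∃ m, IsLeast
      {m : ℕ | 2 < m ∧ ∃ a : Fin m → M, FlatSM.IsCircuit (FlatSM.acl L M) a} m :=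
    ⟨_, Nat.sInf_mem hne, fun _ hk => Nat.sInf_le hk⟩
  obtain ⟨n, rfl⟩ : ∃ n, m = n + 1 := ⟨m - 1, by have := hm.1.1; omega⟩
  refine ⟨n, hm, ?_⟩
  have hn : 2 ≤ n := by have := hm.1.1; omega
  -- A failure of disintegration over fewer than `n` elements would give a circuit of size between
  -- `3` and `n`.
  have hsmall : ∀ I, FlatSM.IndepSet (FlatSM.acl L M) I → I.encard < n →
      ∀ x ∈ FlatSM.acl L M I, x ∉ FlatSM.acl L M ∅ → ∃ a ∈ I, x ∈ FlatSM.acl L M {a} := by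
    intro I _ hIn x hx hx₀
    by_contra! hc
    have hIne : I.Nonempty := by
      rw [Set.nonempty_iff_ne_empty]
      rintro rfl
      exact hx₀ hx
    obtain ⟨k, hk, hkI, hk'⟩ := h.exists_isCircuit hIne hx hc
    have h1 : n + 1 ≤ k := hm.2 ⟨hk, hk'⟩
    have h2 : (k : ℕ∞) < (n + 1 : ℕ) :=
      hkI.trans_lt (by push_cast; exact (ENat.add_lt_add_iff_right ENat.one_ne_top).2 hIn)
    exact absurd (Nat.cast_lt.1 h2) (by omega)
  -- The last entry of one circuit of size `n + 1` depends on the first `n` but on no single one of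
  -- them; homogeneity carries this to every independent `I` of size `n`.
  have hlarge : ∀ I, FlatSM.IndepSet (FlatSM.acl L M) I → I.encard = n →
      ∃ d ∈ FlatSM.acl L M I, d ∉ FlatSM.acl L M ∅ ∧ ∀ a ∈ I, d ∉ FlatSM.acl L M {a} := by
    intro I hI hIn
    obtain ⟨a, ha⟩ := hm.1.2
    obtain ⟨ha1, ha2, ha3⟩ := h.indepTuple_init_of_isCircuit hn ha
    have hIfin : I.Finite := Set.finite_of_encard_eq_coe hIn
    have hIcard : Nat.card I = n := by
      rw [Nat.card_coe_set_eq, Set.ncard, hIn]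
      rfl
    have := hIfin.to_subtype
    let e := (Finite.equivFinOfCardEq hIcard).symm
    have hr : Set.range (fun i => (e i : M)) = I := by
      ext y
      exact ⟨by rintro ⟨i, rfl⟩; exact (e i).2, fun hy => ⟨e.symm ⟨y, hy⟩, by simp⟩⟩
    have hc : FlatSM.IndepTuple (FlatSM.acl L M) (fun i => (e i : M)) :=
      h.indepTuple_iff.2 ⟨Subtype.val_injective.comp e.injective, hr.symm ▸ hI⟩
    obtain ⟨d, hd, hdI⟩ := FlatSM.exists_mem_acl_of_indepTuple hmin ha1 hc ha2 ha3
    rw [hr] at hd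
    refine ⟨d, hd, fun hd₀ => ?_, fun a ha => ?_⟩
    · exact hdI ⟨0, by omega⟩ (h.mono (Set.empty_subset _) hd₀)
    · simpa using hdI (e.symm ⟨a, ha⟩)
  obtain ⟨B, f, hB, hf⟩ := FlatSM.exists_elementaryEmbedding_acl hT hM hP (k := n + 1)
    fun B hB hBc => h.infinite_cl_of_isFlat hflat hn hsmall hlarge hB hBc
  exact (FlatSM.dim_univ_le hmin (hT.isMinimalStructure hP.1) f hf).trans (by exact_mod_cast hB)
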